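/- Let $w:\{0,1,2,\dots\}\to(0,\infty)$ be a reinforcement weight function. Let $\mathcal G$ be a finite connected graph with at least one edge, and let $\ell_0^e\ge 0$ be integer initial weights on its edges. The edge-reinforced random walk on $\mathcal G$ starts at a vertex at time $t_0=\sum_{e}\ell_0^e$. When it is at a vertex $u$ at time $n$, it jumps to a neighbor $v$ of $u$ with conditional probability, given the past, $$\frac{w(X_n^{\{u,v\}})}{\sum_{y\sim u}w(X_n^{\{u,y\}})},$$ where $X_n^e$ is $\ell_0^e$ plus the number of traversals of $e$ (in either direction) before time $n$. Writing $I_n$ for its position at time $n\ge t_0$, the time of attraction is $$T=\inf\{k\ge t_0:\ \{I_n,I_{n+1}\}=\{I_{n+1},I_{n+2}\}\ \text{for all } n\ge k\}\in\{t_0,t_0+1,\dots\}\cup\{\infty\},$$ and $T^+=T-t_0$. Let $\bar P^{a,b}$ be the law of this walk on the graph with vertices $-1,0,1$ and edges $\{-1,0\}$, $\{0,1\}$, with initial weights $a$ and $b$ respectively, started at $0$ (so that $t_0=a+b$). **Lemma 15.** Let $\mathcal G$ be a finite tree with at least one edge, let $\ell_0^e=1$ for every edge $e$, let $P^{\mathcal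 G}$ be the law of the edge-reinforced random walk on $\mathcal G$ started at an arbitrary vertex, and let $m(\mathcal G)$ be the number of unordered pairs of distinct edges of $\mathcal G$ that meet at a vertex. Then, for every integer $k\ge 0$, $$P^{\mathcal G}(T^+>k)\le m(\mathcal G)\left(\bar P^{1,1}\left(T>\frac{k}{m(\mathcal G)}\right)+\bar P^{1,2}\left(T>\frac{k}{m(\mathcal G)}\right)\right)$$ (if $m(\mathcal G)=0$, the right-hand side is read as $0$). -/

import Mathlib

open MeasureTheory ProbabilityTheory
open scoped ENNReal

noncomputable section

namespace ERRW

variable {V : Type*}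

/-- `X_n^e`: the weight of the edge `e` after the first `n` steps of the path `x`, that is, its
initial weight `ℓ₀ e` plus the number of (undirected) traversals of `e` among these steps. -/
def edgeWeight (ℓ₀ : Sym2 V → ℕ) (x : ℕ → V) (n : ℕ) (e : Sym2 V) : ℕ :=
  ℓ₀ e + {i : ℕ | i < n ∧ s(x i, x (i + 1)) = e}.ncard

open Classical in
/-- The unnormalized probability `w (X_n^{x_n, u}) 1_{u ∼ x_n}` of a jump from `x n` to `u`. -/
def jumpWeight (G : SimpleGraph V) (w : ℕ → ℝ) (ℓ₀ : Sym2 V → ℕ) (x : ℕ → V) (n : ℕ) (u : V) :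
    ℝ≥0∞ :=
  if G.Adj (x n) u then ENNReal.ofReal (w (edgeWeight ℓ₀ x n s(x n, u))) else 0

lemma tsum_jumpWeight_ne_top [Finite V] (G : SimpleGraph V) (w : ℕ → ℝ) (ℓ₀ : Sym2 V → ℕ)
    (x : ℕ → V) (n : ℕ) : ∑' u, jumpWeight G w ℓ₀ x n u ≠ ∞ := by
  have := Fintype.ofFinite V
  rw [tsum_fintype, ENNReal.sum_ne_top]
  intro u _
  unfold jumpWeight
  split_ifs <;> simp

open Classical in
/-- The law of the position after step `n + 1` of the walk, given that its path up to step `n` is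
that of `x`: the jump from `x n` to an adjacent `u` has probability
`w (X_n^{x_n, u}) / ∑_{y ∼ x_n} w (X_n^{x_n, y})`. (For positive `w`, the first branch occurs only
if `x n` is an isolated vertex; the walk then stays where it is.) -/
def step [Finite V] (G : SimpleGraph V) (w : ℕ → ℝ) (ℓ₀ : Sym2 V → ℕ) (x : ℕ → V) (n : ℕ) :
    PMF V :=
  if h : ∑' u, jumpWeight G w ℓ₀ x n u = 0 then PMF.pure (x n)
  else PMF.normalize (jumpWeight G w ℓ₀ x n) h (tsum_jumpWeight_ne_top G w ℓ₀ x n)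

/-- A finite path `h 0, …, h n`, prolonged by its last vertex. -/
def prolong (n : ℕ) (h : (i : Finset.Iic n) → V) (i : ℕ) : V :=
  h ⟨min i n, Finset.mem_Iic.2 (min_le_right i n)⟩

variable [Finite V] [MeasurableSpace V] [DiscreteMeasurableSpace V]

/-- The transition kernel from the history up to step `n` to the position after step `n + 1`. -/
def stepKernel (G : SimpleGraph V) (w : ℕ → ℝ) (ℓ₀ : Sym2 V → ℕ) (n : ℕ) :
    Kernel ((i : Finset.Iic n) → V) V :=
  Kernel.ofFunOfCountable fun h ↦ (step G w ℓ₀ (prolong n h) n).toMeasure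

instance (G : SimpleGraph V) (w : ℕ → ℝ) (ℓ₀ : Sym2 V → ℕ) (n : ℕ) :
    IsMarkovKernel (stepKernel G w ℓ₀ n) :=
  ⟨fun h ↦ inferInstanceAs (IsProbabilityMeasure (step G w ℓ₀ (prolong n h) n).toMeasure)⟩

/-- `P^G`: the law, on the space of infinite paths, of the edge-reinforced random walk on the
finite graph `G` with reinforcement weight function `w`, initial weights `ℓ₀` and initial position
`v₀`. The path is indexed by the number of steps made. -/
def law (G : SimpleGraph V) (w : ℕ → ℝ) (ℓ₀ : Sym2 V → ℕ) (v₀ : V) : Measure (ℕ → V) :=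
  Kernel.traj (X := fun _ ↦ V) (stepKernel G w ℓ₀) 0 fun _ ↦ v₀

/-- Initial weights on the path `0 ∼ 1 ∼ 2`: `a` on the edge `{0, 1}` and `b` on `{1, 2}`. -/
def twoEdgeWeights (a b : ℕ) (e : Sym2 (Fin 3)) : ℕ := if e = s(0, 1) then a else b

/-- `P̄^{a,b}`: the law of the walk on the path with three vertices `0 ∼ 1 ∼ 2`, started at the
middle vertex, with initial weights `a` on the edge `{0, 1}` and `b` on the edge `{1, 2}`. -/
def twoEdgeLaw (w : ℕ → ℝ) (a b : ℕ) : Measure (ℕ → Fin 3) :=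
  law (SimpleGraph.pathGraph 3) w (twoEdgeWeights a b) 1

section Time

variable {V : Type*}

open Classical in
/-- `t₀`: the sum of the initial weights over the edges of the finite graph `G`. The walk starts
at time `t₀`; its position at time `t₀ + j` is its position after `j` steps. -/
def initialTime [Fintype V] (G : SimpleGraph V) (ℓ₀ : Sym2 V → ℕ) : ℕ :=
  ∑ e ∈ G.edgeFinset, ℓ₀ e

/-- `T⁺ = T - t₀`: the first `j` such that all steps of the path after the first `j` ones traverse
the same edge (`⊤` if there is none). -/
def attractionSteps (x : ℕ → V) : ℕ∞ :=
  ⨅ (j : ℕ) (_ : ∀ n ≥ j, s(x n, x (n + 1)) = s(x (n + 1), x (n + 2))), (j : ℕ∞)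

/-- `T`: the time of attraction, on the clock that starts at `t₀`. -/
def attractionTime [Fintype V] (G : SimpleGraph V) (ℓ₀ : Sym2 V → ℕ) (x : ℕ → V) : ℕ∞ :=
  initialTime G ℓ₀ + attractionSteps x

/-- `m(G)`: the number of (unordered) pairs of distinct edges of `G` that meet at a vertex. -/
def adjacentEdgePairs (G : SimpleGraph V) : ℕ :=
  {p : Finset (Sym2 V) | p.card = 2 ∧ (∀ e ∈ p, e ∈ G.edgeSet) ∧ ∃ v, ∀ e ∈ p, v ∈ e}.ncard

end Time

/-- The time of attraction `T` of a path on the two-edge graph with initial weights `a`, `b`. -/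
def twoEdgeTime (a b : ℕ) (x : ℕ → Fin 3) : ℕ∞ :=
  attractionTime (SimpleGraph.pathGraph 3) (twoEdgeWeights a b) x

end ERRW

end

/-! If the walk is not attracted after `k` steps, charge each step up to a later change of edge to
the pair of edges exchanged at the next change; this pair contains the edge of the step. As more
than `k` steps are shared among `m` pairs, some pair sees a change after more than `k / m` crossings
of its two edges (`exists_late_change`). A union bound leaves one pair `s(v, a)`, `s(v, b)` to
treat.

In a tree each of these edges is crossed alternately outwards and back. Hence, whenever the walk is
at `v`, their weights depend only on the starting point and on the numbers of earlier jumps from `v`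
to `a` and to `b` (`IsSide.edgeWeight_add`). Given that the next jump goes to `a` or `b`, the choice
is that of an urn, whatever happens elsewhere. The tree walk may run out of choices, which only
makes a late change less likely (`law_late_choices_le`); the two-edge walk makes a choice at every
second step and so realizes the whole urn (`lateProb_le_twoEdgeLaw`). There, a late change delays
attraction (`div_lt_twoEdgeTime_of_late`).

The start lies behind at most one of the two edges. That edge is crossed once before the first
choice, so the urn starts from weights `1, 2` instead of `1, 1`. -/

namespace ERRW

/-! ### Markov property and almost sure properties of the walk -/

section Law

variable {V : Type*}

lemma edgeWeight_congr (ℓ₀ : Sym2 V → ℕ) {x y : ℕ → V} {n : ℕ} (h : ∀ i ≤ n, x i = y i)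
    (e : Sym2 V) : edgeWeight ℓ₀ x n e = edgeWeight ℓ₀ y n e := by
  unfold edgeWeight
  congr 2
  ext i
  refine and_congr_right fun hi ↦ ?_
  rw [h i hi.le, h (i + 1) hi]

lemma jumpWeight_congr (G : SimpleGraph V) (w : ℕ → ℝ) (ℓ₀ : Sym2 V → ℕ) {x y : ℕ → V} {n : ℕ}
    (h : ∀ i ≤ n, x i = y i) : jumpWeight G w ℓ₀ x n = jumpWeight G w ℓ₀ y n := by
  funext u
  unfold jumpWeight
  rw [edgeWeight_congr ℓ₀ h, h n le_rfl]

lemma step_congr [Finite V] (G : SimpleGraph V) (w : ℕ → ℝ) (ℓ₀ : Sym2 V → ℕ) {x y : ℕ → V}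
    {n : ℕ} (h : ∀ i ≤ n, x i = y i) : step G w ℓ₀ x n = step G w ℓ₀ y n := by
  simp only [step, jumpWeight_congr G w ℓ₀ h, h n le_rfl]

lemma prolong_restrict (x : ℕ → V) {n i : ℕ} (hi : i ≤ n) :
    prolong n (Preorder.frestrictLe (π := fun _ ↦ V) n x) i = x i := by
  simp [prolong, hi]

lemma step_apply_eq [Finite V] {G : SimpleGraph V} {w : ℕ → ℝ} (hw : ∀ n, 0 < w n) (ℓ₀ : Sym2 V → ℕ)
    {x : ℕ → V} {n : ℕ} {y : V} (hy : G.Adj (x n) y) (u : V) :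
    step G w ℓ₀ x n u = jumpWeight G w ℓ₀ x n u * (∑' u, jumpWeight G w ℓ₀ x n u)⁻¹ := by
  have h : ∑' u, jumpWeight G w ℓ₀ x n u ≠ 0 := by
    rw [Ne, ENNReal.tsum_eq_zero, not_forall]
    exact ⟨y, by simp [jumpWeight, hy, hw]⟩
  rw [step, dif_neg h, PMF.normalize_apply]

variable [Finite V] [MeasurableSpace V] [DiscreteMeasurableSpace V]

instance (G : SimpleGraph V) (w : ℕ → ℝ) (ℓ₀ : Sym2 V → ℕ) (v₀ : V) :
    IsProbabilityMeasure (law G w ℓ₀ v₀) := by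
  unfold law; infer_instance

/-- A function of the path which depends on finitely many steps only is measurable. -/
lemma measurable_of_adapted {β : Type*} [MeasurableSpace β] {f : (ℕ → V) → β} (n : ℕ)
    (hf : ∀ x y : ℕ → V, (∀ i ≤ n, x i = y i) → f x = f y) : Measurable f := by
  have h : f = (fun h ↦ f (prolong n h)) ∘ Preorder.frestrictLe (π := fun _ ↦ V) n := by
    funext x
    exact hf _ _ fun i hi ↦ (prolong_restrict x hi).symm
  rw [h]
  exact (measurable_of_countable _).comp (by fun_prop)

/-- The one-step Markov property of the walk. -/
lemma lintegral_law_succ [Fintype V] (G : SimpleGraph V) (w : ℕ → ℝ) (ℓ₀ : Sym2 V → ℕ) (v₀ : V)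
    (n : ℕ) (F : (ℕ → V) → V → ℝ≥0∞)
    (hF : ∀ x y : ℕ → V, (∀ i ≤ n, x i = y i) → F x = F y) :
    ∫⁻ x, F x (x (n + 1)) ∂law G w ℓ₀ v₀ =
      ∫⁻ x, ∑ u, step G w ℓ₀ x n u * F x u ∂law G w ℓ₀ v₀ := by
  have key := Kernel.partialTraj_compProd_eq_map_traj (X := fun _ ↦ V)
    (κ := stepKernel G w ℓ₀) (Nat.zero_le n) (x₀ := fun _ ↦ v₀)
  let g : (((i : Finset.Iic n) → V) × V) → ℝ≥0∞ := fun p ↦ F (prolong n p.1) p.2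
  have hg : Measurable g := measurable_of_countable _
  have hres (x : ℕ → V) : ∀ i ≤ n, x i = prolong n (Preorder.frestrictLe (π := fun _ ↦ V) n x) i :=
    fun i hi ↦ (prolong_restrict x hi).symm
  have h1 : ∫⁻ x, F x (x (n + 1)) ∂law G w ℓ₀ v₀ =
      ∫⁻ p, g p ∂(law G w ℓ₀ v₀).map
        (fun x ↦ (Preorder.frestrictLe (π := fun _ ↦ V) n x, x (n + 1))) := by
    rw [lintegral_map hg (by fun_prop)]
    refine lintegral_congr fun x ↦ ?_
    simp only [g]
    rw [hF _ _ (hres x)]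
  rw [h1, law, ← key, Measure.lintegral_compProd hg, ← Kernel.traj_map_frestrictLe_apply,
    lintegral_map (measurable_of_countable _) (by fun_prop)]
  refine lintegral_congr fun x ↦ ?_
  rw [lintegral_fintype]
  refine Finset.sum_congr rfl fun u _ ↦ ?_
  simp only [g, stepKernel, Kernel.ofFunOfCountable, Kernel.coe_mk]
  rw [PMF.toMeasure_apply_singleton _ _ (measurableSet_singleton u), mul_comm,
    ← hF _ _ (hres x), ← step_congr G w ℓ₀ (hres x)]

lemma ae_law_zero (G : SimpleGraph V) (w : ℕ → ℝ) (ℓ₀ : Sym2 V → ℕ) (v₀ : V) :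
    ∀ᵐ x ∂law G w ℓ₀ v₀, x 0 = v₀ := by
  have h := Kernel.traj_map_frestrictLe_apply (X := fun _ ↦ V) (κ := stepKernel G w ℓ₀) 0 0
    (fun _ ↦ v₀)
  rw [Kernel.partialTraj_self, Kernel.id_apply] at h
  have h2 : ∀ᵐ p ∂(law G w ℓ₀ v₀).map (Preorder.frestrictLe (π := fun _ ↦ V) 0),
      p = fun _ ↦ v₀ := by
    rw [law, h, ae_dirac_eq]
    exact rfl
  filter_upwards [ae_of_ae_map (by fun_prop) h2] with x hx
  exact congrFun hx ⟨0, by simp⟩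

/-- A non-neighbour has jump weight zero, and `hG` excludes the isolated vertices at which the walk
would stay put. -/
lemma ae_law_adj {G : SimpleGraph V} {w : ℕ → ℝ} (hw : ∀ n, 0 < w n)
    (hG : ∀ v, ∃ u, G.Adj v u) (ℓ₀ : Sym2 V → ℕ) (v₀ : V) :
    ∀ᵐ x ∂law G w ℓ₀ v₀, ∀ n, G.Adj (x n) (x (n + 1)) := by
  classical
  have := Fintype.ofFinite V
  rw [ae_all_iff]
  intro n
  have h := lintegral_law_succ G w ℓ₀ v₀ n (fun x u ↦ if G.Adj (x n) u then 0 else 1)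
    (fun x y hxy ↦ by simp only [hxy n le_rfl])
  have h0 (x : ℕ → V) :
      ∑ u, step G w ℓ₀ x n u * (if G.Adj (x n) u then 0 else 1 : ℝ≥0∞) = 0 := by
    refine Finset.sum_eq_zero fun u _ ↦ ?_
    obtain ⟨y, hy⟩ := hG (x n)
    rw [step_apply_eq hw ℓ₀ hy]
    by_cases hu : G.Adj (x n) u <;> simp [jumpWeight, hu]
  simp only [h0, lintegral_zero] at h
  rw [lintegral_eq_zero_iff] at h
  · filter_upwards [h] with x hx
    by_contra hc
    simp [hc] at hx
  · refine measurable_of_adapted (n + 1) fun x y hxy ↦ ?_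
    rw [hxy n (by simp), hxy (n + 1) le_rfl]

end Law

end ERRW

namespace ERRW

/-! ### The two sides of an edge of a tree -/

section Sides

variable {V : Type*} {G : SimpleGraph V} {v a b : V} {A B : Set V}

/-- `A` contains the neighbour `a` of `v` but not `v`, and can be left or entered only along the
edge between `a` and `v`: for a tree, `A` is the part of the tree behind `a`, seen from `v`. -/
structure IsSide (G : SimpleGraph V) (v a : V) (A : Set V) : Prop where
  mem : a ∈ A
  notMem : v ∉ A
  eq_of_adj : ∀ ⦃u u' : V⦄, G.Adj u u' → u ∈ A → u' ∉ A → u = a ∧ u' = v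

lemma IsSide.notMem_of_adj (hA : IsSide G v a A) (hb : G.Adj v b) (hab : a ≠ b) : b ∉ A :=
  fun h ↦ hab (hA.eq_of_adj hb.symm h hA.notMem).1.symm

/-- Every edge of an acyclic graph is a bridge: take the component of `a` once the edge is deleted.
-/
lemma exists_isSide (hG : G.IsAcyclic) (ha : G.Adj v a) : ∃ A, IsSide G v a A := by
  refine ⟨{u | (G.deleteEdges {s(v, a)}).Reachable a u}, SimpleGraph.Reachable.refl a, ?_, ?_⟩
  · intro h
    exact SimpleGraph.isBridge_iff.1
      (SimpleGraph.isAcyclic_iff_forall_isBridge.1 hG (e := s(v, a)) ha) h.symm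
  · intro u u' huu' hu hu'
    by_contra hc
    by_cases he : s(u, u') = s(v, a)
    · rcases Sym2.eq_iff.1 he with h | h
      · exact hu' (by rw [h.2]; exact SimpleGraph.Reachable.refl a)
      · exact hc h
    · refine hu' (SimpleGraph.Reachable.trans hu (SimpleGraph.Adj.reachable ?_))
      simp [SimpleGraph.deleteEdges_adj, huu', he]

/-- The sides of two different edges at a vertex are disjoint. -/
lemma IsSide.disjoint (hG : G.Connected) (hA : IsSide G v a A) (hB : IsSide G v b B)
    (ha : G.Adj v a) (hb : G.Adj v b) (hab : a ≠ b) (u : V) : ¬ (u ∈ A ∧ u ∈ B) := by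
  obtain ⟨p⟩ := hG.preconnected v u
  suffices h : ∀ {y z : V}, G.Walk y z → ¬ (y ∈ A ∧ y ∈ B) → ¬ (z ∈ A ∧ z ∈ B) from
    h p fun h ↦ hA.notMem h.1
  intro y z p
  induction p with
  | nil => exact id
  | @cons y y' z h p ih =>
    refine fun hy ↦ ih fun hy' ↦ ?_
    -- A step into the intersection enters one of the sides, hence ends at `a` or `b`, which is not
    -- on the other side.
    by_cases hyA : y ∈ A
    · have := hB.eq_of_adj h.symm hy'.2 fun hyB ↦ hy ⟨hyA, hyB⟩
      exact hA.notMem_of_adj hb hab (this.1 ▸ hy'.1)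
    · have := hA.eq_of_adj h.symm hy'.1 hyA
      exact hB.notMem_of_adj ha hab.symm (this.1 ▸ hy'.2)

end Sides

/-! ### Edge weights and late changes in terms of the choices at `v` -/

section Choices

variable {V : Type*} {G : SimpleGraph V} {v a b : V} {A B : Set V} {x : ℕ → V}

open Classical in
/-- Add a jump from `p` to `u` to the list of jumps from `v` to `a` (`true`) or `b` (`false`). -/
noncomputable def record (v a b : V) (l : List Bool) (p u : V) : List Bool :=
  if p = v ∧ u = a then true :: l else if p = v ∧ u = b then false :: l else l

/-- The list of the jumps from `v` to `a` (`true`) or `b` (`false`) among the first `n` steps of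
the path `x`, the last one first. -/
noncomputable def choices (v a b : V) (x : ℕ → V) : ℕ → List Bool
  | 0 => []
  | n + 1 => record v a b (choices v a b x n) (x n) (x (n + 1))

lemma choices_succ (n : ℕ) :
    choices v a b x (n + 1) = record v a b (choices v a b x n) (x n) (x (n + 1)) := rfl

lemma record_of_ne (l : List Bool) {p : V} (u : V) (hp : p ≠ v) : record v a b l p u = l := by
  simp [record, hp]

lemma record_left (l : List Bool) : record v a b l v a = true :: l := by
  simp [record]

lemma record_right (hab : a ≠ b) (l : List Bool) : record v a b l v b = false :: l := by
  simp [record, hab.symm]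

lemma record_other (l : List Bool) {u : V} (ha : u ≠ a) (hb : u ≠ b) :
    record v a b l v u = l := by
  simp [record, ha, hb]

lemma choices_congr {y : ℕ → V} {n : ℕ} (h : ∀ i ≤ n, x i = y i) :
    choices v a b x n = choices v a b y n := by
  induction n with
  | zero => rfl
  | succ n ih =>
    rw [choices_succ, choices_succ, ih fun i hi ↦ h i (hi.trans n.le_succ), h n n.le_succ,
      h (n + 1) le_rfl]

open Classical in
lemma edgeWeight_succ (ℓ₀ : Sym2 V → ℕ) (x : ℕ → V) (n : ℕ) (e : Sym2 V) :
    edgeWeight ℓ₀ x (n + 1) e =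
      edgeWeight ℓ₀ x n e + if s(x n, x (n + 1)) = e then 1 else 0 := by
  have hfin (n : ℕ) : {i : ℕ | i < n ∧ s(x i, x (i + 1)) = e}.Finite :=
    (Set.finite_lt_nat n).subset fun i hi ↦ hi.1
  unfold edgeWeight
  split_ifs with h
  · have : {i : ℕ | i < n + 1 ∧ s(x i, x (i + 1)) = e} =
        insert n {i : ℕ | i < n ∧ s(x i, x (i + 1)) = e} := by
      ext i
      simp only [Set.mem_ofPred_eq, Set.mem_insert_iff, Nat.lt_succ_iff_lt_or_eq]
      refine ⟨fun hi ↦ ?_, ?_⟩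
      · exact hi.1.elim (fun h' ↦ Or.inr ⟨h', hi.2⟩) Or.inl
      · rintro (rfl | hi)
        · exact ⟨Or.inr rfl, h⟩
        · exact ⟨Or.inl hi.1, hi.2⟩
    rw [this, Set.ncard_insert_of_notMem (by simp) (hfin n), add_assoc]
  · have : {i : ℕ | i < n + 1 ∧ s(x i, x (i + 1)) = e} =
        {i : ℕ | i < n ∧ s(x i, x (i + 1)) = e} := by
      ext i
      simp only [Set.mem_ofPred_eq, Nat.lt_succ_iff_lt_or_eq]
      refine ⟨fun hi ↦ ⟨hi.1.resolve_right ?_, hi.2⟩, fun hi ↦ ⟨Or.inl hi.1, hi.2⟩⟩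
      rintro rfl
      exact h hi.2
    rw [this, add_zero]

open Classical in
/-- The edge from `v` to `a` is crossed alternately in its two directions. -/
lemma IsSide.edgeWeight_add (hA : IsSide G v a A) (hx : ∀ n, G.Adj (x n) (x (n + 1)))
    (ℓ₀ : Sym2 V → ℕ) {N : ℕ → ℕ} (h0 : N 0 = 0)
    (hN : ∀ n, N (n + 1) = N n + if x n = v ∧ x (n + 1) = a then 1 else 0) (n : ℕ) :
    edgeWeight ℓ₀ x n s(v, a) + (if x n ∈ A then 1 else 0) =
      ℓ₀ s(v, a) + 2 * N n + if x 0 ∈ A then 1 else 0 := by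
  induction n with
  | zero => simp [edgeWeight, h0]
  | succ n ih =>
    have hva : v ≠ a := fun h ↦ hA.notMem (h ▸ hA.mem)
    rw [edgeWeight_succ, hN]
    -- An outward crossing adds 2 to both sides of the identity; in a return the weight gains what
    -- the indicator loses; no other step changes `x n ∈ A`.
    by_cases h1 : x n = v ∧ x (n + 1) = a
    · simp only [h1, hA.mem, hA.notMem, and_self, if_true, if_false] at ih ⊢
      omega
    by_cases h2 : x n = a ∧ x (n + 1) = v
    · have : s(a, v) = s(v, a) := Sym2.eq_swap
      simp only [h2, hA.mem, hA.notMem, hva, hva.symm, this, and_self, if_true, if_false] at ih ⊢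
      omega
    have he : s(x n, x (n + 1)) ≠ s(v, a) := fun h ↦ (Sym2.eq_iff.1 h).elim h1 h2
    have hiff : x n ∈ A ↔ x (n + 1) ∈ A := by
      constructor <;> intro h <;> by_contra h'
      · exact h2 (hA.eq_of_adj (hx n) h h')
      · exact h1 (hA.eq_of_adj (hx n).symm h h').symm
    simp only [he, h1, if_false, hiff] at ih ⊢
    omega

open Classical in
lemma IsSide.edgeWeight_left (hA : IsSide G v a A)
    (hx : ∀ n, G.Adj (x n) (x (n + 1))) (ℓ₀ : Sym2 V → ℕ) {n : ℕ} (hn : x n = v) :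
    edgeWeight ℓ₀ x n s(v, a) =
      (ℓ₀ s(v, a) + if x 0 ∈ A then 1 else 0) + 2 * (choices v a b x n).count true := by
  have h := hA.edgeWeight_add hx ℓ₀ (N := fun n ↦ (choices v a b x n).count true) rfl
    (fun n ↦ by
      simp only [choices_succ, record]
      by_cases h1 : x n = v ∧ x (n + 1) = a
      · simp [h1]
      · simp only [h1, if_false, add_zero]
        split_ifs <;> simp) n
  rw [hn, if_neg hA.notMem] at h
  omega

open Classical in
lemma IsSide.edgeWeight_right (hB : IsSide G v b B) (hab : a ≠ b)
    (hx : ∀ n, G.Adj (x n) (x (n + 1))) (ℓ₀ : Sym2 V → ℕ) {n : ℕ} (hn : x n = v) :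
    edgeWeight ℓ₀ x n s(v, b) =
      (ℓ₀ s(v, b) + if x 0 ∈ B then 1 else 0) + 2 * (choices v a b x n).count false := by
  have h := hB.edgeWeight_add hx ℓ₀ (N := fun n ↦ (choices v a b x n).count false) rfl
    (fun n ↦ by
      simp only [choices_succ, record]
      by_cases h1 : x n = v ∧ x (n + 1) = b
      · simp [h1, hab.symm]
      · simp only [h1, if_false, add_zero]
        split_ifs <;> simp) n
  rw [hn, if_neg hB.notMem] at h
  omega

/-- After a jump from `v` to `b`, the walk can enter the side of `a` only through `v`. -/
lemma IsSide.notMem_of_head_false (hA : IsSide G v a A) (hb : G.Adj v b) (hab : a ≠ b)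
    (hx : ∀ n, G.Adj (x n) (x (n + 1))) {n : ℕ}
    (h : (choices v a b x n).head? = some false) : x n ∉ A := by
  induction n with
  | zero => simp [choices] at h
  | succ n ih =>
    rw [choices_succ, record] at h
    split_ifs at h with h1 h2
    · simp at h
    · rw [h2.2]
      exact hA.notMem_of_adj hb hab
    · exact fun hc ↦ h1 (hA.eq_of_adj (hx n).symm hc (ih h)).symm

/-- After a jump from `v` to `a`, the walk can enter the side of `b` only through `v`. -/
lemma IsSide.notMem_of_head_true (hB : IsSide G v b B) (ha : G.Adj v a) (hab : a ≠ b)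
    (hx : ∀ n, G.Adj (x n) (x (n + 1))) {n : ℕ}
    (h : (choices v a b x n).head? = some true) : x n ∉ B := by
  induction n with
  | zero => simp [choices] at h
  | succ n ih =>
    rw [choices_succ, record] at h
    split_ifs at h with h1 h2
    · rw [h1.2]
      exact hB.notMem_of_adj ha hab.symm
    · simp at h
    · exact fun hc ↦ h2 (hB.eq_of_adj (hx n).symm hc (ih h)).symm

/-- The list of choices shows a change `l.head? = !c`, and the clock `s + 2 * l.length` at this
change is above `k / m` (or already the initial clock `s` is). -/
def Late (k m s : ℕ) : List Bool → Prop
  | [] => k < m * s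
  | c :: l => Late k m s l ∨ l.head? = some (!c) ∧ k < m * (s + 2 * l.length)

lemma Late.of_lt {k m s : ℕ} (h : k < m * s) : ∀ l, Late k m s l
  | [] => h
  | _ :: l => Or.inl (Late.of_lt h l)

open Classical in
lemma ncard_crossings_le (hA : IsSide G v a A) (hB : IsSide G v b B) (hab : a ≠ b)
    (hx : ∀ n, G.Adj (x n) (x (n + 1))) (h0 : x 0 ∉ A) {n : ℕ} (hn : x n = v) :
    {i : ℕ | i < n ∧ s(x i, x (i + 1)) ∈ ({s(v, a), s(v, b)} : Finset (Sym2 V))}.ncard ≤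
      (if x 0 ∈ B then 1 else 0) + 2 * (choices v a b x n).length := by
  -- With zero initial weights, the edge weight is the number of crossings.
  have h1 := hA.edgeWeight_left (b := b) hx (fun _ ↦ 0) hn
  have h2 := hB.edgeWeight_right hab hx (fun _ ↦ 0) hn
  have h3 : {i : ℕ | i < n ∧ s(x i, x (i + 1)) ∈ ({s(v, a), s(v, b)} : Finset (Sym2 V))} =
      {i : ℕ | i < n ∧ s(x i, x (i + 1)) = s(v, a)} ∪
        {i : ℕ | i < n ∧ s(x i, x (i + 1)) = s(v, b)} := by
    ext i
    simp only [Finset.mem_insert, Finset.mem_singleton, Set.mem_ofPred_eq, Set.mem_union]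
    tauto
  have h4 := List.count_true_add_count_false (choices v a b x n)
  rw [h3]
  refine (Set.ncard_union_le _ _).trans ?_
  simp only [edgeWeight, if_neg h0] at h1 h2
  omega

open Classical in
/-- A late change between the two edges in the tree shows in the list of choices. -/
lemma late_choices (hA : IsSide G v a A) (hB : IsSide G v b B) (ha : G.Adj v a) (hb : G.Adj v b)
    (hab : a ≠ b) (hx : ∀ n, G.Adj (x n) (x (n + 1))) (h0 : x 0 ∉ A) {k m c : ℕ}
    (hc : s(x c, x (c + 1)) ≠ s(x (c + 1), x (c + 2)))
    (hp : ({s(x c, x (c + 1)), s(x (c + 1), x (c + 2))} : Finset (Sym2 V)) = {s(v, a), s(v, b)})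
    (hk : k < m * {i : ℕ | i < c + 1 ∧
      s(x i, x (i + 1)) ∈ ({s(v, a), s(v, b)} : Finset (Sym2 V))}.ncard) :
    Late k m (2 + if x 0 ∈ B then 1 else 0) (choices v a b x (c + 2)) := by
  have hva := ha.ne
  have hvb := hb.ne
  have hpath : x (c + 1) = v ∧ (x c = a ∧ x (c + 2) = b ∨ x c = b ∧ x (c + 2) = a) := by
    have e1 : s(x c, x (c + 1)) ∈ ({s(v, a), s(v, b)} : Finset (Sym2 V)) := by
      rw [← hp]; simp
    have e2 : s(x (c + 1), x (c + 2)) ∈ ({s(v, a), s(v, b)} : Finset (Sym2 V)) := by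
      rw [← hp]; simp
    simp only [Finset.mem_insert, Finset.mem_singleton, Sym2.eq_iff] at e1 e2
    simp only [ne_eq, Sym2.eq_iff] at hc
    grind
  obtain ⟨hv, hpath⟩ := hpath
  have hle := ncard_crossings_le hA hB hab hx h0 hv
  have hk' := hk.trans_le (Nat.mul_le_mul_left m hle)
  have hxc : x c ≠ v := hv ▸ (hx c).ne
  -- Step `c` starts outside `v`, so the latest choice at time `c + 1` also tells which side the
  -- walk can be on at time `c`.
  have hL : choices v a b x (c + 1) = choices v a b x c := by
    rw [choices_succ, record_of_ne _ _ hxc]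
  rw [show c + 2 = c + 1 + 1 from rfl, choices_succ]
  generalize hl : choices v a b x (c + 1) = l at *
  match l with
  | [] =>
    -- Without an earlier choice the pair has been crossed at most once, on arrival from behind `b`,
    -- so the initial clock alone exceeds `k / m`.
    refine Late.of_lt (hk'.trans_le (Nat.mul_le_mul_left m ?_)) _
    simp
  | d :: l =>
    have hk2 : k < m * ((2 + if x 0 ∈ B then 1 else 0) + 2 * (d :: l).length) :=
      hk'.trans_le (Nat.mul_le_mul_left m (by omega))
    rcases hpath with ⟨h1, h2⟩ | ⟨h1, h2⟩
    · have hd : d = true := by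
        by_contra hd
        rw [Bool.not_eq_true] at hd
        exact hA.notMem_of_head_false hb hab hx (n := c) (by rw [← hL, hd]; rfl)
          (h1 ▸ hA.mem)
      rw [hv, show x (c + 1 + 1) = b from h2, record_right hab]
      exact Or.inr ⟨by simp [hd], hk2⟩
    · have hd : d = false := by
        by_contra hd
        rw [Bool.not_eq_false] at hd
        exact hB.notMem_of_head_true ha hab hx (n := c) (by rw [← hL, hd]; rfl)
          (h1 ▸ hB.mem)
      rw [hv, show x (c + 1 + 1) = a from h2, record_left]
      exact Or.inr ⟨by simp [hd], hk2⟩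

end Choices

/-! ### Pigeonhole over the pairs of adjacent edges -/

section Cover

variable {V : Type*} {G : SimpleGraph V} {x : ℕ → V}

/-- The pairs of distinct edges that meet at a vertex. -/
def edgePairs (G : SimpleGraph V) : Set (Finset (Sym2 V)) :=
  {p | p.card = 2 ∧ (∀ e ∈ p, e ∈ G.edgeSet) ∧ ∃ v, ∀ e ∈ p, v ∈ e}

lemma exists_of_mem_edgePairs [DecidableEq V] {p : Finset (Sym2 V)} (hp : p ∈ edgePairs G) :
    ∃ v a b, G.Adj v a ∧ G.Adj v b ∧ a ≠ b ∧ p = {s(v, a), s(v, b)} := by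
  obtain ⟨h2, hG, v, hv⟩ := hp
  obtain ⟨e, f, hef, rfl⟩ := Finset.card_eq_two.1 h2
  obtain ⟨a, rfl⟩ := Sym2.mem_iff_exists.1 (hv e (by simp))
  obtain ⟨b, rfl⟩ := Sym2.mem_iff_exists.1 (hv f (by simp))
  exact ⟨v, a, b, hG s(v, a) (by simp), hG s(v, b) (by simp), fun h ↦ hef (h ▸ rfl), by ext; simp⟩

open Classical in
/-- If the walk is not attracted after `k` steps, then some pair of edges sees a change after more
than `k / m` crossings of these two edges. -/
lemma exists_late_change [Finite V] (hx : ∀ n, G.Adj (x n) (x (n + 1))) {k : ℕ}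
    (hk : (k : ℕ∞) < attractionSteps x) :
    ∃ p ∈ edgePairs G, ∃ c, s(x c, x (c + 1)) ≠ s(x (c + 1), x (c + 2)) ∧
      {s(x c, x (c + 1)), s(x (c + 1), x (c + 2))} = p ∧
      k < adjacentEdgePairs G * {i : ℕ | i < c + 1 ∧ s(x i, x (i + 1)) ∈ p}.ncard := by
  obtain ⟨n, hkn, hn⟩ : ∃ n ≥ k, s(x n, x (n + 1)) ≠ s(x (n + 1), x (n + 2)) := by
    by_contra! h
    exact hk.not_ge (iInf₂_le k h)
  let D : Finset ℕ := (Finset.range (n + 1)).filter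
    fun j ↦ s(x j, x (j + 1)) ≠ s(x (j + 1), x (j + 2))
  let q : ℕ → Finset (Sym2 V) := fun j ↦ {s(x j, x (j + 1)), s(x (j + 1), x (j + 2))}
  have hq (j : ℕ) (hj : j ∈ D) : q j ∈ edgePairs G := by
    refine ⟨Finset.card_pair (Finset.mem_filter.1 hj).2, ?_, x (j + 1), ?_⟩
    · intro e he
      rcases Finset.mem_insert.1 he with rfl | he
      · exact hx j
      · rw [Finset.mem_singleton.1 he]; exact hx (j + 1)
    · intro e he
      rcases Finset.mem_insert.1 he with rfl | he
      · simp
      · rw [Finset.mem_singleton.1 he]; simp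
  have hfin : (edgePairs G).Finite := Set.toFinite _
  have hm : adjacentEdgePairs G = hfin.toFinset.card := Set.ncard_eq_toFinset_card _ hfin
  let S : Finset (Sym2 V) → Finset ℕ := fun p ↦ (Finset.range (n + 1)).filter
    fun i ↦ s(x i, x (i + 1)) ∈ p ∧ ∃ j ∈ D, i ≤ j ∧ q j = p
  have hcover : Finset.range (n + 1) ⊆ hfin.toFinset.biUnion S := by
    intro i hi
    have hin : i ≤ n := Nat.lt_succ_iff.1 (Finset.mem_range.1 hi)
    have hex : ∃ j, i ≤ j ∧ s(x j, x (j + 1)) ≠ s(x (j + 1), x (j + 2)) := ⟨n, hin, hn⟩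
    -- `j` is the first change at or after `i`; the same edge is traversed from step `i` to step
    -- `j`.
    obtain ⟨j, ⟨hij, hj⟩, hmin⟩ : ∃ j, (i ≤ j ∧ s(x j, x (j + 1)) ≠ s(x (j + 1), x (j + 2))) ∧
        ∀ l < j, ¬ (i ≤ l ∧ s(x l, x (l + 1)) ≠ s(x (l + 1), x (l + 2))) :=
      ⟨Nat.find hex, Nat.find_spec hex, fun l hl ↦ Nat.find_min hex hl⟩
    have hjn : j ≤ n := not_lt.1 fun h ↦ hmin n h ⟨hin, hn⟩
    have hjD : j ∈ D := Finset.mem_filter.2 ⟨Finset.mem_range.2 (Nat.lt_succ_of_le hjn), hj⟩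
    have hconst : ∀ l, i ≤ l → l ≤ j → s(x l, x (l + 1)) = s(x i, x (i + 1)) := by
      intro l hil
      induction l, hil using Nat.le_induction with
      | base => exact fun _ ↦ rfl
      | succ l hil ih =>
        intro hlj
        rw [← ih (Nat.le_of_succ_le hlj)]
        by_contra h
        exact hmin l hlj ⟨hil, fun h' ↦ h h'.symm⟩
    refine Finset.mem_biUnion.2 ⟨q j, hfin.mem_toFinset.2 (hq j hjD),
      Finset.mem_filter.2 ⟨hi, ?_, j, hjD, hij, rfl⟩⟩
    rw [← hconst j hij le_rfl]
    simp [q]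
  have hcard : n + 1 ≤ ∑ p ∈ hfin.toFinset, (S p).card := by
    simpa using (Finset.card_le_card hcover).trans Finset.card_biUnion_le
  obtain ⟨p, hp, hkp⟩ : ∃ p ∈ hfin.toFinset, k < hfin.toFinset.card * (S p).card := by
    by_contra! h
    have h1 : hfin.toFinset.card * (n + 1) ≤ hfin.toFinset.card * k :=
      calc
        _ ≤ hfin.toFinset.card * ∑ p ∈ hfin.toFinset, (S p).card := Nat.mul_le_mul_left _ hcard
        _ ≤ ∑ p ∈ hfin.toFinset, k := by
          rw [Finset.mul_sum]; exact Finset.sum_le_sum h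
        _ = _ := by simp
    have hpos : 0 < hfin.toFinset.card := Finset.card_pos.2 ⟨q n, hfin.mem_toFinset.2
      (hq n (Finset.mem_filter.2 ⟨by simp, hn⟩))⟩
    have := Nat.le_of_mul_le_mul_left h1 hpos
    omega
  have hSp : (S p).Nonempty := Finset.card_pos.1 (Nat.pos_of_mul_pos_left (Nat.zero_lt_of_lt hkp))
  have hne : (D.filter fun j ↦ q j = p).Nonempty := by
    obtain ⟨i, hi⟩ := hSp
    obtain ⟨-, -, j, hj, -, hjp⟩ := Finset.mem_filter.1 hi
    exact ⟨j, Finset.mem_filter.2 ⟨hj, hjp⟩⟩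
  -- The last change of the pair `p` up to `n`: all steps in `S p` come at or before it.
  obtain ⟨c, hc, hmax⟩ := Finset.exists_max_image _ id hne
  obtain ⟨hcD, hcp⟩ := Finset.mem_filter.1 hc
  refine ⟨p, hfin.mem_toFinset.1 hp, c, (Finset.mem_filter.1 hcD).2, hcp, ?_⟩
  rw [hm]
  refine hkp.trans_le (Nat.mul_le_mul_left _ ?_)
  rw [← Set.ncard_coe_finset]
  refine Set.ncard_le_ncard (fun i hi ↦ ?_) ((Set.finite_lt_nat (c + 1)).subset fun i hi ↦ hi.1)
  obtain ⟨-, hip, j, hj, hij, hjp⟩ := Finset.mem_filter.1 (Finset.mem_coe.1 hi)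
  exact ⟨Nat.lt_succ_of_le (hij.trans (hmax j (Finset.mem_filter.2 ⟨hj, hjp⟩))), hip⟩

end Cover

end ERRW

namespace ERRW

/-! ### The urn of choices between two edges -/

section Urn

variable (w : ℕ → ℝ) (k m α β : ℕ)

/-- The weight of the edge `true` after the choices `l`. -/
noncomputable def leftWeight (l : List Bool) : ℝ≥0∞ := ENNReal.ofReal (w (α + 2 * l.count true))

/-- The weight of the edge `false` after the choices `l`. -/
noncomputable def rightWeight (l : List Bool) : ℝ≥0∞ := ENNReal.ofReal (w (β + 2 * l.count false))

open Classical in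
/-- The probability that the urn of the choices between two edges with initial weights `α` and `β`
shows a late change within the next `n` choices, given the choices `l` made so far. -/
noncomputable def lateProb : ℕ → List Bool → ℝ≥0∞
  | 0, l => if Late k m (α + β) l then 1 else 0
  | n + 1, l => (leftWeight w α l * lateProb n (true :: l) +
      rightWeight w β l * lateProb n (false :: l)) / (leftWeight w α l + rightWeight w β l)

variable {w} {α β}

lemma leftWeight_ne_zero (hw : ∀ n, 0 < w n) (l : List Bool) : leftWeight w α l ≠ 0 := by
  simp [leftWeight, hw]

lemma leftWeight_ne_top (l : List Bool) : leftWeight w α l ≠ ∞ := ENNReal.ofReal_ne_top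

lemma rightWeight_ne_top (l : List Bool) : rightWeight w β l ≠ ∞ := ENNReal.ofReal_ne_top

lemma lateProb_succ_mul (hw : ∀ n, 0 < w n) (n : ℕ) (l : List Bool) :
    (leftWeight w α l + rightWeight w β l) * lateProb w k m α β (n + 1) l =
      leftWeight w α l * lateProb w k m α β n (true :: l) +
        rightWeight w β l * lateProb w k m α β n (false :: l) :=
  ENNReal.mul_div_cancel (by simp [leftWeight_ne_zero hw])
    (by simp [leftWeight_ne_top, rightWeight_ne_top])

/-- Lateness survives further choices, so it can only become more likely over a longer horizon. -/
lemma lateProb_le_succ (hw : ∀ n, 0 < w n) (n : ℕ) (l : List Bool) :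
    lateProb w k m α β n l ≤ lateProb w k m α β (n + 1) l := by
  have key (n : ℕ) (l : List Bool) (r : ℝ≥0∞) (h : ∀ c, r ≤ lateProb w k m α β n (c :: l)) :
      r ≤ lateProb w k m α β (n + 1) l := by
    refine (ENNReal.mul_le_mul_iff_right (a := leftWeight w α l + rightWeight w β l)
      (by simp [leftWeight_ne_zero hw]) (by simp [leftWeight_ne_top, rightWeight_ne_top])).1 ?_
    rw [lateProb_succ_mul k m hw, add_mul]
    gcongr <;> exact h _
  induction n generalizing l with
  | zero =>
    refine key 0 l _ fun c ↦ ?_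
    by_cases h : Late k m (α + β) l
    · have : Late k m (α + β) (c :: l) := Or.inl h
      simp [lateProb, h, this]
    · simp [lateProb, h]
  | succ n ih =>
    rw [lateProb]
    refine ENNReal.div_le_of_le_mul' ?_
    rw [lateProb_succ_mul k m hw]
    gcongr <;> exact ih _

end Urn

/-! ### The tree walk is dominated by the urn -/

section Comparison

variable {V : Type*} [Fintype V] {G : SimpleGraph V} {v a b : V} {A B : Set V} {x : ℕ → V}
  {w : ℕ → ℝ} {ℓ₀ : Sym2 V → ℕ} {α β : ℕ} (k m : ℕ)

/-- At `v`, the walk chooses between the edges to `a` and `b` like the urn. -/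
lemma step_mul_add_step_mul (hw : ∀ n, 0 < w n) (ha : G.Adj v a) (hb : G.Adj v b) {n : ℕ}
    (hn : x n = v) (l : List Bool) (hwa : edgeWeight ℓ₀ x n s(v, a) = α + 2 * l.count true)
    (hwb : edgeWeight ℓ₀ x n s(v, b) = β + 2 * l.count false) (M : ℕ) :
    step G w ℓ₀ x n a * lateProb w k m α β M (true :: l) +
        step G w ℓ₀ x n b * lateProb w k m α β M (false :: l) =
      step G w ℓ₀ x n a * lateProb w k m α β (M + 1) l +
        step G w ℓ₀ x n b * lateProb w k m α β (M + 1) l := by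
  have hna : G.Adj (x n) a := hn ▸ ha
  have h1 : jumpWeight G w ℓ₀ x n a = leftWeight w α l := by
    simp only [jumpWeight, hn, ha, if_true, leftWeight, hwa]
  have h2 : jumpWeight G w ℓ₀ x n b = rightWeight w β l := by
    simp only [jumpWeight, hn, hb, if_true, rightWeight, hwb]
  rw [step_apply_eq hw ℓ₀ hna, step_apply_eq hw ℓ₀ hna, h1, h2]
  -- Other neighbours of `v` affect only the normalization, a common factor of the urn recursion.
  have h := congrArg ((∑' u, jumpWeight G w ℓ₀ x n u)⁻¹ * ·)
    (lateProb_succ_mul k m hw (α := α) (β := β) M l)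
  calc
    _ = _ := by rw [mul_right_comm, mul_right_comm (rightWeight w β l), ← add_mul, mul_comm]
    _ = _ := h.symm
    _ = _ := by ring

lemma sum_eq_add_add_sum {f : V → ℝ≥0∞} [DecidableEq V] (hab : a ≠ b) :
    ∑ u, f u = f a + f b + ∑ u ∈ (Finset.univ.erase a).erase b, f u := by
  rw [← Finset.add_sum_erase _ f (Finset.mem_univ a),
    ← Finset.add_sum_erase _ f (Finset.mem_erase.2 ⟨hab.symm, Finset.mem_univ b⟩), add_assoc]

lemma sum_step_mul (x : ℕ → V) (n : ℕ) (r : ℝ≥0∞) : ∑ u, step G w ℓ₀ x n u * r = r := by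
  rw [← Finset.sum_mul, ← tsum_fintype (L := .unconditional V), PMF.tsum_coe, one_mul]

/-- This is a supermartingale inequality: a jump from `v` to `a` or `b` follows the urn exactly, and
any other step wastes one unit of the horizon. -/
lemma sum_step_le (hw : ∀ n, 0 < w n) (ha : G.Adj v a) (hb : G.Adj v b) (hab : a ≠ b) {n : ℕ}
    (l : List Bool)
    (hwa : x n = v → edgeWeight ℓ₀ x n s(v, a) = α + 2 * l.count true)
    (hwb : x n = v → edgeWeight ℓ₀ x n s(v, b) = β + 2 * l.count false) (M : ℕ) :
    ∑ u, step G w ℓ₀ x n u * lateProb w k m α β M (record v a b l (x n) u) ≤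
      lateProb w k m α β (M + 1) l := by
  classical
  rw [← sum_step_mul (G := G) (w := w) (ℓ₀ := ℓ₀) x n (lateProb w k m α β (M + 1) l)]
  by_cases hn : x n = v
  · rw [sum_eq_add_add_sum hab, sum_eq_add_add_sum hab, hn, record_left, record_right hab,
      step_mul_add_step_mul k m hw ha hb hn l (hwa hn) (hwb hn)]
    refine add_le_add le_rfl (Finset.sum_le_sum fun u hu ↦ ?_)
    simp only [Finset.mem_erase] at hu
    rw [record_other _ hu.2.1 hu.1]
    exact mul_le_mul_right (lateProb_le_succ k m hw M l) _
  · refine Finset.sum_le_sum fun u _ ↦ ?_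
    rw [record_of_ne _ _ hn]
    exact mul_le_mul_right (lateProb_le_succ k m hw M l) _

variable [MeasurableSpace V] [DiscreteMeasurableSpace V]

lemma lintegral_lateProb_zero (μ : Measure (ℕ → V)) (n : ℕ) :
    ∫⁻ x, lateProb w k m α β 0 (choices v a b x n) ∂μ =
      μ {x | Late k m (α + β) (choices v a b x n)} := by
  classical
  have hmeas : MeasurableSet {x | Late k m (α + β) (choices v a b x n)} := by
    have : Measurable fun x ↦ Late k m (α + β) (choices v a b x n) :=
      measurable_of_adapted n fun x y h ↦ by rw [choices_congr h]
    exact measurableSet_setOfPred.2 this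
  rw [← lintegral_indicator_one hmeas]
  rfl

/-- The walk on the tree is not more likely to show a late change than the urn. -/
lemma law_late_choices_le (hw : ∀ n, 0 < w n) (hG : ∀ v, ∃ u, G.Adj v u) (v₀ : V)
    (ha : G.Adj v a) (hb : G.Adj v b) (hab : a ≠ b)
    (hwt : ∀ x : ℕ → V, x 0 = v₀ → (∀ n, G.Adj (x n) (x (n + 1))) → ∀ n, x n = v →
      edgeWeight ℓ₀ x n s(v, a) = α + 2 * (choices v a b x n).count true ∧
      edgeWeight ℓ₀ x n s(v, b) = β + 2 * (choices v a b x n).count false) (N : ℕ) :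
    law G w ℓ₀ v₀ {x | Late k m (α + β) (choices v a b x N)} ≤ lateProb w k m α β N [] := by
  rw [← lintegral_lateProb_zero]
  suffices h : ∀ n ≤ N, ∫⁻ x, lateProb w k m α β (N - n) (choices v a b x n) ∂law G w ℓ₀ v₀ ≤
      lateProb w k m α β N [] by
    simpa using h N le_rfl
  intro n
  induction n with
  | zero => simp [choices]
  | succ n ih =>
    intro hn
    refine le_trans ?_ (ih (Nat.le_of_succ_le hn))
    simp only [choices_succ]
    rw [lintegral_law_succ G w ℓ₀ v₀ n (fun x u ↦ lateProb w k m α β (N - (n + 1))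
      (record v a b (choices v a b x n) (x n) u))
      fun x y h ↦ by rw [choices_congr h, h n le_rfl]]
    refine lintegral_mono_ae ?_
    filter_upwards [ae_law_zero G w ℓ₀ v₀, ae_law_adj hw hG ℓ₀ v₀] with x h0 hx
    rw [show N - n = N - (n + 1) + 1 by omega]
    exact sum_step_le k m hw ha hb hab _ (fun h ↦ (hwt x h0 hx n h).1)
      (fun h ↦ (hwt x h0 hx n h).2) _

end Comparison

/-! ### The two-edge walk realizes the urn -/

section TwoEdge

open SimpleGraph (pathGraph pathGraph_adj)

variable {w : ℕ → ℝ} (k m α β : ℕ) {x : ℕ → Fin 3}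

lemma pathGraph_three_adj {u u' : Fin 3} (h : (pathGraph 3).Adj u u') : u = 1 ↔ u' ≠ 1 := by
  rw [pathGraph_adj] at h
  omega

lemma pathGraph_three_exists_adj (u : Fin 3) : ∃ u', (pathGraph 3).Adj u u' := by
  simp only [pathGraph_adj]
  decide +revert

lemma isSide_zero : IsSide (pathGraph 3) 1 0 {0} := by
  refine ⟨rfl, by simp, fun u u' h hu hu' ↦ ?_⟩
  rw [pathGraph_adj] at h
  simp only [Set.mem_singleton_iff] at hu hu'
  omega

lemma isSide_two : IsSide (pathGraph 3) 1 2 {2} := by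
  refine ⟨rfl, by simp, fun u u' h hu hu' ↦ ?_⟩
  rw [pathGraph_adj] at h
  simp only [Set.mem_singleton_iff] at hu hu'
  omega

lemma adj_one_zero : (pathGraph 3).Adj 1 0 := by simp [pathGraph_adj]

lemma adj_one_two : (pathGraph 3).Adj 1 2 := by simp [pathGraph_adj]

lemma eq_one_iff_even (h0 : x 0 = 1) (hx : ∀ n, (pathGraph 3).Adj (x n) (x (n + 1))) (n : ℕ) :
    x n = 1 ↔ Even n := by
  induction n with
  | zero => simp [h0]
  | succ n ih =>
    rw [Nat.even_add_one, ← ih, pathGraph_three_adj (hx n), not_not]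

lemma twoEdge_edgeWeight (h0 : x 0 = 1) (hx : ∀ n, (pathGraph 3).Adj (x n) (x (n + 1)))
    {n : ℕ} (hn : x n = 1) :
    edgeWeight (twoEdgeWeights α β) x n s(1, 0) = α + 2 * (choices 1 0 2 x n).count true ∧
    edgeWeight (twoEdgeWeights α β) x n s(1, 2) = β + 2 * (choices 1 0 2 x n).count false := by
  rw [isSide_zero.edgeWeight_left (b := 2) hx _ hn,
    isSide_two.edgeWeight_right (a := 0) (by decide) hx _ hn]
  simp [h0, twoEdgeWeights]

lemma initialTime_twoEdge : initialTime (pathGraph 3) (twoEdgeWeights α β) = α + β := by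
  classical
  have h : (pathGraph 3).edgeFinset = {s(0, 1), s(1, 2)} := by
    ext e
    induction e with
    | _ u u' =>
      simp only [SimpleGraph.mem_edgeFinset, SimpleGraph.mem_edgeSet, pathGraph_adj,
        Finset.mem_insert, Finset.mem_singleton, Sym2.eq_iff]
      omega
  rw [initialTime]
  convert! Finset.sum_pair (f := twoEdgeWeights α β) (a := s(0, 1)) (b := s(1, 2)) (by simp)

lemma le_attractionSteps {V : Type*} {x : ℕ → V} {n : ℕ}
    (h : s(x n, x (n + 1)) ≠ s(x (n + 1), x (n + 2))) : (n + 1 : ℕ) ≤ attractionSteps x := by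
  refine le_iInf₂ fun j hj ↦ ?_
  by_contra! hc
  exact h (hj n (Nat.lt_succ_iff.1 (by exact_mod_cast hc)))

/-- Each choice takes a step out and a step back; the indicator stands for a return still to come.
-/
lemma two_mul_length_choices_le (hx : ∀ n, (pathGraph 3).Adj (x n) (x (n + 1))) (n : ℕ) :
    2 * (choices 1 0 2 x n).length ≤ n + if x n = 1 then 0 else 1 := by
  induction n with
  | zero => simp [choices]
  | succ n ih =>
    have h := pathGraph_three_adj (hx n)
    rw [choices_succ, record]
    by_cases hn : x n = 1
    · rw [if_neg (h.1 hn)]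
      rw [if_pos hn] at ih
      split_ifs <;> simp <;> omega
    · simp only [hn, false_and, if_false] at ih ⊢
      split_ifs <;> omega

lemma div_lt_twoEdgeTime {t : ℕ} (hk : k < m * (α + β + t)) (ht : t ≤ attractionSteps x) :
    (k : ℝ≥0∞) / (m : ℝ≥0∞) < (twoEdgeTime α β x : ℝ≥0∞) := by
  have h1 : ((α + β + t : ℕ) : ℕ∞) ≤ twoEdgeTime α β x := by
    rw [twoEdgeTime, attractionTime, initialTime_twoEdge]
    push_cast
    gcongr
  refine lt_of_lt_of_le ?_ (ENat.toENNReal_le.2 h1)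
  rw [ENat.toENNReal_coe]
  refine ENNReal.div_lt_of_lt_mul' ?_
  exact_mod_cast hk

/-- A late change of the choices at the middle vertex makes the time of attraction large. -/
lemma div_lt_twoEdgeTime_of_late (hx : ∀ n, (pathGraph 3).Adj (x n) (x (n + 1))) {n : ℕ}
    (h : Late k m (α + β) (choices 1 0 2 x n)) :
    (k : ℝ≥0∞) / (m : ℝ≥0∞) < (twoEdgeTime α β x : ℝ≥0∞) := by
  induction n with
  | zero => exact div_lt_twoEdgeTime k m α β (t := 0) h (by simp)
  | succ n ih =>
    have main (d : Bool) (u : Fin 3) (hu : x n = 1 ∧ x (n + 1) = u)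
        (hd : d = true ∧ u = 0 ∨ d = false ∧ u = 2)
        (h : Late k m (α + β) (d :: choices 1 0 2 x n)) :
        (k : ℝ≥0∞) / (m : ℝ≥0∞) < (twoEdgeTime α β x : ℝ≥0∞) := by
      refine h.elim ih fun ⟨hhead, hk⟩ ↦ ?_
      have hlen := two_mul_length_choices_le hx n
      rw [if_pos hu.1, add_zero] at hlen
      match n with
      | 0 => simp [choices] at hhead
      | n + 1 =>
        have hn : x n ≠ 1 := fun h ↦ (pathGraph_three_adj (hx n)).1 h hu.1
        rw [choices_succ, record_of_ne _ _ hn] at hhead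
        have hne : x n ≠ u := by
          rcases hd with ⟨rfl, rfl⟩ | ⟨rfl, rfl⟩
          · exact isSide_zero.notMem_of_head_false adj_one_two (by decide) hx hhead
          · exact isSide_two.notMem_of_head_true adj_one_zero (by decide) hx hhead
        -- Steps `n` and `n + 1` use different edges, so attraction takes at least `n + 1` steps,
        -- which is at least twice the number of earlier choices.
        refine div_lt_twoEdgeTime k m α β hk (le_trans ?_ (le_attractionSteps (n := n) ?_))
        · exact_mod_cast hlen
        · rw [show x (n + 2) = u from hu.2, hu.1, Ne, Sym2.eq_iff]
          exact fun h ↦ h.elim (fun h ↦ hn h.1) fun h ↦ hne h.1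
    rw [choices_succ, record] at h
    split_ifs at h with h1 h2
    · exact main true 0 h1 (by simp) h
    · exact main false 2 h2 (by simp) h
    · exact ih h

/-- The middle vertex has no third neighbour, so no step from it is wasted. -/
lemma le_sum_step (hw : ∀ n, 0 < w n) (h0 : x 0 = 1)
    (hx : ∀ n, (pathGraph 3).Adj (x n) (x (n + 1)))
    {n : ℕ} (hn : x n = 1) (M : ℕ) :
    lateProb w k m α β (M + 1) (choices 1 0 2 x n) ≤
      ∑ u, step (pathGraph 3) w (twoEdgeWeights α β) x n u *
        lateProb w k m α β M (record 1 0 2 (choices 1 0 2 x n) (x n) u) := by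
  have hwt := twoEdge_edgeWeight α β h0 hx hn
  rw [← sum_step_mul (G := pathGraph 3) (w := w) (ℓ₀ := twoEdgeWeights α β) x n
      (lateProb w k m α β (M + 1) (choices 1 0 2 x n)),
    sum_eq_add_add_sum (a := 0) (b := 2) (by decide),
    sum_eq_add_add_sum (a := 0) (b := 2) (by decide), hn, record_left, record_right (by decide),
    step_mul_add_step_mul k m hw adj_one_zero adj_one_two hn _ hwt.1 hwt.2]
  refine add_le_add le_rfl (Finset.sum_le_sum fun u hu ↦ ?_)
  have hu1 : u = 1 := by
    simp only [Finset.mem_erase] at hu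
    omega
  rw [hu1, step_apply_eq hw _ (hx n)]
  simp [jumpWeight, hn]

/-- The walk on the two-edge graph makes a choice of the urn at every second step. -/
lemma lateProb_le_twoEdgeLaw (hw : ∀ n, 0 < w n) (N : ℕ) :
    lateProb w k m α β N [] ≤ twoEdgeLaw w α β
      {x | (k : ℝ≥0∞) / (m : ℝ≥0∞) < (twoEdgeTime α β x : ℝ≥0∞)} := by
  have hadj := ae_law_adj hw pathGraph_three_exists_adj (twoEdgeWeights α β) 1
  -- Starting at the middle, the first `n` steps contain `(n + 1) / 2` choices, rounded down.
  have h (n : ℕ) (hn : n ≤ 2 * N) : lateProb w k m α β N [] ≤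
      ∫⁻ x, lateProb w k m α β (N - (n + 1) / 2) (choices 1 0 2 x n) ∂twoEdgeLaw w α β := by
    rw [twoEdgeLaw]
    induction n with
    | zero => simp [choices]
    | succ n ih =>
      refine (ih (Nat.le_of_succ_le hn)).trans ?_
      simp only [choices_succ]
      rw [lintegral_law_succ (pathGraph 3) w _ 1 n (fun x u ↦
          lateProb w k m α β (N - (n + 1 + 1) / 2)
        (record 1 0 2 (choices 1 0 2 x n) (x n) u))
        fun x y h ↦ by rw [choices_congr h, h n le_rfl]]
      refine lintegral_mono_ae ?_
      filter_upwards [ae_law_zero (pathGraph 3) w (twoEdgeWeights α β) 1, hadj] with x h0 hx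
      have hpar := eq_one_iff_even h0 hx n
      by_cases hxn : x n = 1
      · obtain ⟨i, hi⟩ := hpar.1 hxn
        rw [show N - (n + 1) / 2 = N - (n + 1 + 1) / 2 + 1 by omega]
        exact le_sum_step k m α β hw h0 hx hxn _
      · obtain ⟨i, hi⟩ := Nat.not_even_iff_odd.1 (hpar.not.1 hxn)
        simp only [record_of_ne _ _ hxn]
        rw [sum_step_mul, show (n + 1 + 1) / 2 = (n + 1) / 2 by omega]
  refine (h (2 * N) le_rfl).trans ?_
  rw [show N - (2 * N + 1) / 2 = 0 by omega, lintegral_lateProb_zero]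
  refine measure_mono_ae ?_
  filter_upwards [hadj] with x hx hlate
  exact div_lt_twoEdgeTime_of_late k m α β hx hlate

end TwoEdge

/-! ### The bound for one pair, and the union bound -/

section Main

variable {V : Type*} [Fintype V] [Nontrivial V] [MeasurableSpace V] [DiscreteMeasurableSpace V]
  {G : SimpleGraph V} {w : ℕ → ℝ} {v₀ v a b : V} (k m : ℕ)

open Classical in
/-- The comparison for one pair of edges, the first of which does not lead towards `v₀`. -/
lemma law_late_change_le (hG : G.IsTree) (hw : ∀ n, 0 < w n) {A B : Set V}
    (hA : IsSide G v a A) (hB : IsSide G v b B) (ha : G.Adj v a) (hb : G.Adj v b) (hab : a ≠ b)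
    (h0A : v₀ ∉ A) :
    law G w (fun _ ↦ 1) v₀ {x | ∃ c, s(x c, x (c + 1)) ≠ s(x (c + 1), x (c + 2)) ∧
        ({s(x c, x (c + 1)), s(x (c + 1), x (c + 2))} : Finset (Sym2 V)) = {s(v, a), s(v, b)} ∧
        k < m * {i : ℕ | i < c + 1 ∧
          s(x i, x (i + 1)) ∈ ({s(v, a), s(v, b)} : Finset (Sym2 V))}.ncard} ≤
      twoEdgeLaw w 1 1 {x | (k : ℝ≥0∞) / (m : ℝ≥0∞) < (twoEdgeTime 1 1 x : ℝ≥0∞)} +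
        twoEdgeLaw w 1 2 {x | (k : ℝ≥0∞) / (m : ℝ≥0∞) < (twoEdgeTime 1 2 x : ℝ≥0∞)} := by
  have hadj : ∀ v, ∃ u, G.Adj v u := hG.connected.preconnected.exists_adj_of_nontrivial
  -- From behind `b`, the walk must cross the edge to `v` once before its first choice.
  let β : ℕ := 1 + if v₀ ∈ B then 1 else 0
  have hbound : law G w (fun _ ↦ 1) v₀ (⋃ n, {x | Late k m (1 + β) (choices v a b x n)}) ≤
      twoEdgeLaw w 1 β {x | (k : ℝ≥0∞) / (m : ℝ≥0∞) < (twoEdgeTime 1 β x : ℝ≥0∞)} := by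
    -- Lateness persists, so the events increase and a bound uniform in `n` passes to their union.
    rw [Monotone.measure_iUnion]
    · refine iSup_le fun n ↦ (law_late_choices_le k m hw hadj v₀ ha hb hab ?_ n).trans
        (lateProb_le_twoEdgeLaw k m 1 β hw n)
      intro x h0 hx n hn
      rw [hA.edgeWeight_left (b := b) hx _ hn, hB.edgeWeight_right hab hx _ hn, h0, if_neg h0A]
      exact ⟨rfl, rfl⟩
    · refine monotone_nat_of_le_succ fun n x hx ↦ ?_
      simp only [Set.mem_ofPred_eq, choices_succ, record] at hx ⊢
      split_ifs
      exacts [Or.inl hx, Or.inl hx, hx]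
  refine le_trans (measure_mono_ae ?_) (hbound.trans ?_)
  · filter_upwards [ae_law_zero G w (fun _ ↦ 1) v₀, ae_law_adj hw hadj (fun _ ↦ 1) v₀]
      with x h0 hx
    rintro ⟨c, hc, hp, hk⟩
    refine Set.mem_iUnion.2 ⟨c + 2, ?_⟩
    have := late_choices hA hB ha hb hab hx (h0.symm ▸ h0A) hc hp hk
    rw [h0] at this
    simp only [Set.mem_ofPred_eq, β]
    rwa [← add_assoc]
  · by_cases h : v₀ ∈ B
    · have : β = 2 := by simp [β, h]
      rw [this]
      exact le_add_self
    · have : β = 1 := by simp [β, h]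
      rw [this]
      exact le_self_add

end Main

end ERRW

theorem lemma15 {V : Type*} [Fintype V] [Nontrivial V]
    [MeasurableSpace V] [DiscreteMeasurableSpace V]
    (G : SimpleGraph V) (hG : G.IsTree) (w : ℕ → ℝ) (hw : ∀ n, 0 < w n) (v₀ : V) (k : ℕ) :
    ERRW.law G w (fun _ ↦ 1) v₀ {x | (k : ℕ∞) < ERRW.attractionSteps x} ≤
      (ERRW.adjacentEdgePairs G : ℝ≥0∞) *
        (ERRW.twoEdgeLaw w 1 1
            {x | (k : ℝ≥0∞) / (ERRW.adjacentEdgePairs G : ℝ≥0∞) <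
              (ERRW.twoEdgeTime 1 1 x : ℝ≥0∞)} +
          ERRW.twoEdgeLaw w 1 2
            {x | (k : ℝ≥0∞) / (ERRW.adjacentEdgePairs G : ℝ≥0∞) <
              (ERRW.twoEdgeTime 1 2 x : ℝ≥0∞)}) := by

  classical
  have hfin : (ERRW.edgePairs G).Finite := Set.toFinite _
  have hm : ERRW.adjacentEdgePairs G = hfin.toFinset.card := Set.ncard_eq_toFinset_card _ hfin
  have hadj : ∀ v, ∃ u, G.Adj v u := hG.connected.preconnected.exists_adj_of_nontrivial
  let E : Finset (Sym2 V) → Set (ℕ → V) := fun p ↦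
    {x | ∃ c, s(x c, x (c + 1)) ≠ s(x (c + 1), x (c + 2)) ∧
      {s(x c, x (c + 1)), s(x (c + 1), x (c + 2))} = p ∧
      k < ERRW.adjacentEdgePairs G * {i : ℕ | i < c + 1 ∧ s(x i, x (i + 1)) ∈ p}.ncard}
  have hsub : ERRW.law G w (fun _ ↦ 1) v₀ {x | (k : ℕ∞) < ERRW.attractionSteps x} ≤
      ERRW.law G w (fun _ ↦ 1) v₀ (⋃ p ∈ hfin.toFinset, E p) := by
    refine measure_mono_ae ?_
    filter_upwards [ERRW.ae_law_adj hw hadj (fun _ ↦ 1) v₀] with x hx hk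
    obtain ⟨p, hp, c, hc⟩ := ERRW.exists_late_change hx hk
    exact Set.mem_iUnion₂.2 ⟨p, hfin.mem_toFinset.2 hp, c, hc⟩
  refine (hsub.trans (measure_biUnion_finset_le _ _)).trans ?_
  refine (Finset.sum_le_card_nsmul _ _
    (ERRW.twoEdgeLaw w 1 1 {x | (k : ℝ≥0∞) / (ERRW.adjacentEdgePairs G : ℝ≥0∞) <
        (ERRW.twoEdgeTime 1 1 x : ℝ≥0∞)} +
      ERRW.twoEdgeLaw w 1 2 {x | (k : ℝ≥0∞) / (ERRW.adjacentEdgePairs G : ℝ≥0∞) <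
        (ERRW.twoEdgeTime 1 2 x : ℝ≥0∞)}) fun p hp ↦ ?_).trans_eq
    (by rw [nsmul_eq_mul, ← hm])
  obtain ⟨v, a, b, ha, hb, hab, rfl⟩ := ERRW.exists_of_mem_edgePairs (hfin.mem_toFinset.1 hp)
  obtain ⟨A, hA⟩ := ERRW.exists_isSide hG.isAcyclic ha
  obtain ⟨B, hB⟩ := ERRW.exists_isSide hG.isAcyclic hb
  by_cases h0 : v₀ ∈ A
  -- The start cannot lie on both sides, so exchanging `a` and `b` suffices.
  · have h0B : v₀ ∉ B := fun h ↦ hA.disjoint hG.connected hB ha hb hab v₀ ⟨h0, h⟩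
    rw [Finset.pair_comm]
    exact ERRW.law_late_change_le k _ hG hw hB hA hb ha hab.symm h0B
  · exact ERRW.law_late_change_le k _ hG hw hA hB ha hb hab h0
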